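/- Fix an integer $k\ge 2$. There are constants $c>0$ and $N_0$, depending only on $k$, such that for all $N\ge N_0$ and all $\ell$ with $2^\ell\ge N$ the following holds. Every quantum algorithm that solves the constructive membership problem with respect to $k$ generators in black-box abelian semigroups of order $N$ with labels of length $\ell$, with success probability at least $2/3$ on every instance, makes at least $c\,N^{\frac12-\frac1{2k}}$ queries in the worst case; that is, $\Omega(|S|^{\frac12-\frac1{2k}})$ quantum queries are required. Here an instance consists of a finite abelian semigroup $S=\langle g_1,\ldots,g_k\rangle$ with $|S|=N$, an element $x\in S$, and an injective encoding $\mathrm{enc}\colon S\to\{0,1\}^\ell$. The algorithm is given the labels $\mathrm{enc}(g_1),\ldots,\mathrm{enc}(g_k),\mathrm{enc}(x)$ and may depend on them (and on $k,N,\ell$) arbitrarily; it has access to $S$ only through queries to the unitary black box $$|u,v,c,b\rangle\mapsto|u,v,c\oplus\mathrm{enc}(st),b\oplus1\rangle\quad\text{if } u=\mathrm{enc}(s),\ v=\mathrm{enc}(t) \text{ with } s,t\in S,$$ which fixes $|u,v,c,b\rangle$ if $u$ or $v$ is not the label of an element of $S$ (where $u,v,c\in\{0,1\}^\ell$ and $b\in\{0,1\}$).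 Between queries it may apply arbitrary unitaries that do not depend on the black box, using any finite workspace, and it ends with a measurement in the computational basis. It succeeds if it outputs $a_1,\ldots,a_k\in\{0,1,2,\ldots\}$ with $a_1+\cdots+a_k\ge1$ and $x=g_1^{a_1}\cdots g_k^{a_k}$, where $g_i^0$ means that the factor $g_i$ is absent. -/

import Mathlib

/-- Bit strings of length `ℓ`; they serve as the labels (encodings) of semigroup elements. -/
abbrev BitString (ℓ : ℕ) : Type := Fin ℓ → Bool

/-- Bitwise exclusive or. -/
def BitString.xor {ℓ : ℕ} (u v : BitString ℓ) : BitString ℓ := fun i => Bool.xor (u i) (v i)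

/-- Classical reply of the black box of a semigroup `S` whose elements are uniquely encoded by
`enc`: on the labels of `s` and `t` it is the label of `s * t`; if one of the two strings is not
the label of an element, it is `none` (the box reports that the query is invalid). -/
noncomputable def blackBoxReply {S : Type} [Mul S] {ℓ : ℕ} (enc : S ↪ BitString ℓ)
    (u v : BitString ℓ) : Option (BitString ℓ) :=
  (Function.partialInv enc u).bind fun s =>
    (Function.partialInv enc v).map fun t => enc (s * t)

theorem blackBoxReply_enc {S : Type} [Mul S] {ℓ : ℕ} (enc : S ↪ BitString ℓ) (s t : S) :
    blackBoxReply enc (enc s) (enc t) = some (enc (s * t)) := by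
  simp [blackBoxReply, Function.partialInv_left enc.injective]

theorem blackBoxReply_eq_none {S : Type} [Mul S] {ℓ : ℕ} (enc : S ↪ BitString ℓ)
    {u v : BitString ℓ} (h : u ∉ Set.range enc ∨ v ∉ Set.range enc) :
    blackBoxReply enc u v = none := by
  have key : ∀ w : BitString ℓ, w ∉ Set.range enc → Function.partialInv enc w = none := by
    intro w hw
    exact dif_neg hw
  rcases h with h | h
  · simp [blackBoxReply, key u h]
  · simp [blackBoxReply, key v h]

/-- Computational basis states of a quantum query algorithm: two query registers, a reply register,
a validity bit, and a finite workspace `W`. -/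
abbrev QBasis (ℓ : ℕ) (W : Type) : Type :=
  BitString ℓ × BitString ℓ × BitString ℓ × Bool × W

/-- Action on basis states of the query that computes the reply `f u v`: the string is xored into
the reply register and the validity bit is flipped; invalid queries leave the state unchanged. -/
def queryMap {ℓ : ℕ} {W : Type} (f : BitString ℓ → BitString ℓ → Option (BitString ℓ)) :
    QBasis ℓ W → QBasis ℓ W
  | (u, v, c, b, w) =>
    match f u v with
    | some y => (u, v, BitString.xor c y, !b, w)
    | none => (u, v, c, b, w)

theorem queryMap_involutive {ℓ : ℕ} {W : Type}
    (f : BitString ℓ → BitString ℓ → Option (BitString ℓ)) :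
    Function.Involutive (queryMap (W := W) f) := by
  rintro ⟨u, v, c, b, w⟩
  cases h : f u v with
  | none => simp [queryMap, h]
  | some y =>
    have hc : BitString.xor (BitString.xor c y) y = c := by
      funext i
      simp [BitString.xor]
    simp [queryMap, h, hc]

/-- The query unitary: the permutation `queryMap f` of the basis states, extended linearly. -/
noncomputable def queryUnitary {ℓ : ℕ} {W : Type} [Fintype W]
    (f : BitString ℓ → BitString ℓ → Option (BitString ℓ)) :
    EuclideanSpace ℂ (QBasis ℓ W) ≃ₗᵢ[ℂ] EuclideanSpace ℂ (QBasis ℓ W) :=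
  LinearIsometryEquiv.piLpCongrLeft 2 ℂ ℂ (queryMap_involutive f).toPerm

/-- A quantum query algorithm with outputs in `Out`: a finite workspace, the number of queries, a
unit initial state, the unitary applied after the `t`-th query (`t = 0, 1, …`), and a classical
function of the outcome of the final measurement of all registers in the computational basis. -/
structure QueryAlgorithm (ℓ : ℕ) (Out : Type) where
  W : Type
  [fintypeW : Fintype W]
  queries : ℕ
  init : EuclideanSpace ℂ (QBasis ℓ W)
  norm_init : ‖init‖ = 1
  step : ℕ → EuclideanSpace ℂ (QBasis ℓ W) ≃ₗᵢ[ℂ] EuclideanSpace ℂ (QBasis ℓ W)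
  out : QBasis ℓ W → Out

attribute [instance] QueryAlgorithm.fintypeW

namespace QueryAlgorithm

/-- The state after `t` queries to the box with reply function `f`. -/
noncomputable def stateAfter {ℓ : ℕ} {Out : Type} (A : QueryAlgorithm ℓ Out)
    (f : BitString ℓ → BitString ℓ → Option (BitString ℓ)) :
    ℕ → EuclideanSpace ℂ (QBasis ℓ A.W)
  | 0 => A.init
  | t + 1 => A.step t (queryUnitary f (A.stateAfter f t))

open Classical in
/-- The probability that the final measurement yields an output satisfying `P`. -/
noncomputable def successProb {ℓ : ℕ} {Out : Type} (A : QueryAlgorithm ℓ Out)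
    (f : BitString ℓ → BitString ℓ → Option (BitString ℓ)) (P : Out → Prop) : ℝ :=
  ∑ z : QBasis ℓ A.W, if P (A.out z) then ‖A.stateAfter f A.queries z‖ ^ 2 else 0

end QueryAlgorithm

/-- `a` solves constructive membership for `x` with respect to `g`: the exponents do not all vanish
and `x` is the product of the `g i ^ a i`, where a factor with exponent `0` is absent (the product
is evaluated in `S` with an adjoined identity, which is not an element of `S`). -/
def IsFactorization {S : Type} [CommSemigroup S] {k : ℕ} (g : Fin k → S) (x : S)
    (a : Fin k → ℕ) : Prop :=
  1 ≤ ∑ i, a i ∧ (x : WithOne S) = ∏ i, (g i : WithOne S) ^ a i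

/-- `A` solves, with at most `T` queries and success probability at least `2/3` on every instance,
constructive membership with respect to `k` generators in black-box abelian semigroups of order `N`
with labels of length `ℓ`. The labels of `g 0, …, g (k-1)` and of `x` are the classical input,
on which the algorithm may depend arbitrarily; the semigroup is accessible only via its box. -/
def SolvesConstructiveMembership (k N ℓ T : ℕ)
    (A : (Fin k → BitString ℓ) → BitString ℓ → QueryAlgorithm ℓ (Fin k → ℕ)) : Prop :=
  ∀ (S : Type) [CommSemigroup S] [Finite S] (enc : S ↪ BitString ℓ) (g : Fin k → S) (x : S),
    Nat.card S = N → Subsemigroup.closure (Set.range g) = ⊤ →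
      (A (fun i => enc (g i)) (enc x)).queries ≤ T ∧
      2 / 3 ≤ (A (fun i => enc (g i)) (enc x)).successProb (blackBoxReply enc)
        (IsFactorization g x)

/-!
The hard instances all live in one semigroup, a Rees quotient of the free commutative semigroup on
`k = n + 1` generators: the monomials of degree at most `d`, together with enough further powers of
a single generator to make the order exactly `N`, while all other monomials are identified with a
zero. Every monomial of degree `d` except the pure power of that generator is annihilated by
everything, so such a monomial occurs in the black box only as a product, never as a useful factor.
Permuting the labels of these monomials therefore yields a family of black boxes with the same
labels of the generators, in which one query reveals at most one value of the permutation
(`blackBoxReply_relabel_congr`). If the target is the element carrying a fixed label of this layer,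
a factorization of the target names the monomial that carries it, and so inverts the permutation at
one point (`sqrt_ncard_le_of_solves`). With `d` of order `N ^ (1 / k)`, the layer has of order
`N ^ (1 - 1 / k)` elements (`pow_le_ncard_topLayer`).

Inverting a permutation of `M` points takes of order `√M` quantum queries
(`QueryAlgorithm.sqrt_le_queries_of_inverts`). This is proved by Ambainis' adversary method: each
permutation `π` is paired with the `M - 1` permutations `swap x₀ y * π`, whose preimage of `x₀` is
another one. The sum of the inner products of the states belonging to paired permutations is
`M! * (M - 1)` at the start and at most `17 / 18` of that at the end, because the correct outputs
are disjoint. Two paired boxes differ at only two points. Of these, the one that depends on `π`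
alone carries weight at most `1` for each of the `M - 1` pairs of `π`, whereas the other varies
with `y`, so its weights add up to at most `1` over all pairs. Balancing the two contributions,
one query decreases the sum by at most `4 * √(M - 1) * M!`.
-/

/-! ### Query weights and the effect of one query -/

theorem queryUnitary_apply {ℓ : ℕ} {W : Type} [Fintype W]
    (f : BitString ℓ → BitString ℓ → Option (BitString ℓ))
    (ψ : EuclideanSpace ℂ (QBasis ℓ W)) (z : QBasis ℓ W) :
    queryUnitary f ψ z = ψ (queryMap f z) := rfl

theorem queryMap_fst {ℓ : ℕ} {W : Type} (f : BitString ℓ → BitString ℓ → Option (BitString ℓ))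
    (z : QBasis ℓ W) : (queryMap f z).1 = z.1 ∧ (queryMap f z).2.1 = z.2.1 := by
  obtain ⟨u, v, c, b, w⟩ := z
  cases h : f u v <;> simp [queryMap, h]

theorem queryMap_congr {ℓ : ℕ} {W : Type}
    {f g : BitString ℓ → BitString ℓ → Option (BitString ℓ)} {z : QBasis ℓ W}
    (h : f z.1 z.2.1 = g z.1 z.2.1) : queryMap f z = queryMap g z := by
  obtain ⟨u, v, c, b, w⟩ := z
  simp only at h
  simp [queryMap, h]

section weight

variable {ℓ : ℕ} {W ι : Type} [Fintype W] [DecidableEq ι]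

/-- The probability that measuring the two query registers of `ψ` yields a pair of strings that is
classified as `q` by `key`. -/
noncomputable def queryWeight (key : BitString ℓ → BitString ℓ → Option ι)
    (ψ : EuclideanSpace ℂ (QBasis ℓ W)) (q : ι) : ℝ :=
  ∑ z : QBasis ℓ W, if key z.1 z.2.1 = some q then ‖ψ z‖ ^ 2 else 0

theorem queryWeight_queryUnitary (key : BitString ℓ → BitString ℓ → Option ι)
    (f : BitString ℓ → BitString ℓ → Option (BitString ℓ))
    (ψ : EuclideanSpace ℂ (QBasis ℓ W)) (q : ι) :
    queryWeight key (queryUnitary f ψ) q = queryWeight key ψ q := by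
  unfold queryWeight
  refine Fintype.sum_equiv (queryMap_involutive f).toPerm _ _ fun z => ?_
  simp [queryUnitary_apply, queryMap_fst]

theorem queryWeight_nonneg (key : BitString ℓ → BitString ℓ → Option ι)
    (ψ : EuclideanSpace ℂ (QBasis ℓ W)) (q : ι) : 0 ≤ queryWeight key ψ q :=
  Finset.sum_nonneg fun z _ => by split_ifs <;> positivity

theorem sum_queryWeight_le (key : BitString ℓ → BitString ℓ → Option ι)
    (ψ : EuclideanSpace ℂ (QBasis ℓ W)) (s : Finset ι) :
    ∑ q ∈ s, queryWeight key ψ q ≤ ‖ψ‖ ^ 2 := by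
  unfold queryWeight
  rw [Finset.sum_comm, EuclideanSpace.norm_sq_eq]
  refine Finset.sum_le_sum fun z _ => ?_
  cases h : key z.1 z.2.1 with
  | none => simp
  | some p =>
    simp only [Option.some.injEq, Finset.sum_ite_eq]
    split_ifs
    · exact le_rfl
    · positivity

theorem queryWeight_le (key : BitString ℓ → BitString ℓ → Option ι)
    (ψ : EuclideanSpace ℂ (QBasis ℓ W)) (q : ι) : queryWeight key ψ q ≤ ‖ψ‖ ^ 2 := by
  simpa using sum_queryWeight_le key ψ {q}

theorem re_inner_sub_le {ε : ℝ} (hε : 0 < ε) (a b c : ℂ) :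
    (inner ℂ a b).re - (inner ℂ a c).re ≤
      ε * ‖a‖ ^ 2 + ε⁻¹ / 2 * (‖b‖ ^ 2 + ‖c‖ ^ 2) := by
  have key : ∀ d : ℂ, ‖a‖ * ‖d‖ ≤ ε / 2 * ‖a‖ ^ 2 + ε⁻¹ / 2 * ‖d‖ ^ 2 := fun d => by
    have h : ε / 2 * ‖a‖ ^ 2 + ε⁻¹ / 2 * ‖d‖ ^ 2 - ‖a‖ * ‖d‖
        = ε⁻¹ / 2 * (ε * ‖a‖ - ‖d‖) ^ 2 := by
      field_simp
      ring
    have : 0 ≤ ε⁻¹ / 2 * (ε * ‖a‖ - ‖d‖) ^ 2 := by positivity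
    linarith
  have hb : (inner ℂ a b).re ≤ ‖a‖ * ‖b‖ := (Complex.re_le_norm _).trans (norm_inner_le_norm a b)
  have hc : -(inner ℂ a c).re ≤ ‖a‖ * ‖c‖ :=
    (neg_le_abs _).trans ((Complex.abs_re_le_norm _).trans (norm_inner_le_norm a c))
  linarith [key b, key c]

/-- Queries to two boxes that differ only on pairs classified as `p` or `q` can decrease an inner
product only as far as the two states put weight on `p` and `q`. The parameter `ε` is the one of
the inequality between arithmetic and geometric mean, used with opposite balance for `p` and for
`q`. -/
theorem re_inner_sub_re_inner_queryUnitary_le (key : BitString ℓ → BitString ℓ → Option ι)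
    {f g : BitString ℓ → BitString ℓ → Option (BitString ℓ)} {p q : ι}
    (hfg : ∀ u v, key u v ≠ some p → key u v ≠ some q → f u v = g u v)
    (ψ φ : EuclideanSpace ℂ (QBasis ℓ W)) {ε : ℝ} (hε : 0 < ε) :
    (inner ℂ ψ φ).re - (inner ℂ (queryUnitary f ψ) (queryUnitary g φ)).re ≤
      ε * queryWeight key ψ p + ε⁻¹ * queryWeight key φ p +
        (ε⁻¹ * queryWeight key ψ q + ε * queryWeight key φ q) := by
  have hw : ∀ δ : ℝ, ∀ r : ι, δ * queryWeight key ψ r + δ⁻¹ * queryWeight key φ r =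
      ∑ z : QBasis ℓ W, if key z.1 z.2.1 = some r then
        δ * ‖queryUnitary f ψ z‖ ^ 2 + δ⁻¹ / 2 *
          (‖queryUnitary f φ z‖ ^ 2 + ‖queryUnitary g φ z‖ ^ 2) else 0 := fun δ r => by
    have h1 := queryWeight_queryUnitary key f ψ r
    have h2 := queryWeight_queryUnitary key f φ r
    have h3 := queryWeight_queryUnitary key g φ r
    calc δ * queryWeight key ψ r + δ⁻¹ * queryWeight key φ r
        = δ * queryWeight key (queryUnitary f ψ) r + δ⁻¹ / 2 *
          (queryWeight key (queryUnitary f φ) r + queryWeight key (queryUnitary g φ) r) := by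
          rw [h1, h2, h3]; ring
      _ = _ := by
          unfold queryWeight
          rw [← Finset.sum_add_distrib, Finset.mul_sum, Finset.mul_sum, ← Finset.sum_add_distrib]
          refine Finset.sum_congr rfl fun z _ => ?_
          split_ifs <;> ring
  have hp := hw ε p
  have hq := hw ε⁻¹ q
  rw [inv_inv] at hq
  rw [hp, hq, ← (queryUnitary f).inner_map_map ψ φ, PiLp.inner_apply, PiLp.inner_apply,
    Complex.re_sum, Complex.re_sum, ← Finset.sum_sub_distrib, ← Finset.sum_add_distrib]
  refine Finset.sum_le_sum fun z _ => ?_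
  have hε' : 0 < ε⁻¹ := inv_pos.2 hε
  have b1 := re_inner_sub_le hε (queryUnitary f ψ z) (queryUnitary f φ z) (queryUnitary g φ z)
  have b2 := re_inner_sub_le hε' (queryUnitary f ψ z) (queryUnitary f φ z) (queryUnitary g φ z)
  rw [inv_inv] at b2
  split_ifs with h1 h2 h2
  · have : 0 ≤ ε⁻¹ * ‖queryUnitary f ψ z‖ ^ 2 + ε / 2 *
          (‖queryUnitary f φ z‖ ^ 2 + ‖queryUnitary g φ z‖ ^ 2) := by positivity
    linarith
  · simpa using b1
  · simpa using b2
  · have : queryUnitary f φ z = queryUnitary g φ z := by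
      rw [queryUnitary_apply, queryUnitary_apply, queryMap_congr (hfg _ _ h1 h2)]
    simp [this]

end weight

/-! ### Distinguishability of final states -/

/-- Two unit vectors with disjoint sets of measurement outcomes, each of probability at least `2/3`
for its vector, have inner product bounded away from `1`. -/
theorem re_inner_le_of_separated {α : Type} [Fintype α] {ψ φ : EuclideanSpace ℂ α}
    (hψ : ‖ψ‖ = 1) (hφ : ‖φ‖ = 1) (P Q : α → Prop) [DecidablePred P] [DecidablePred Q]
    (hPQ : ∀ z, P z → ¬ Q z)
    (h1 : 2 / 3 ≤ ∑ z, if P z then ‖ψ z‖ ^ 2 else 0)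
    (h2 : 2 / 3 ≤ ∑ z, if Q z then ‖φ z‖ ^ 2 else 0) :
    (inner ℂ ψ φ).re ≤ 17 / 18 := by
  have n1 : ∑ z, ‖ψ z‖ ^ 2 = 1 := by rw [← EuclideanSpace.norm_sq_eq, hψ]; norm_num
  have n2 : ∑ z, ‖φ z‖ ^ 2 = 1 := by rw [← EuclideanSpace.norm_sq_eq, hφ]; norm_num
  rw [PiLp.inner_apply, Complex.re_sum]
  have hz : ∀ z, (inner ℂ (ψ z) (φ z)).re ≤
      2 / 3 * ‖ψ z‖ ^ 2 - 7 / 24 * (if P z then ‖ψ z‖ ^ 2 else 0) +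
        (2 / 3 * ‖φ z‖ ^ 2 - 7 / 24 * (if Q z then ‖φ z‖ ^ 2 else 0)) := fun z => by
    -- Weighted arithmetic-geometric means with ratio `3 / 4` on `P`, `4 / 3` on `Q`, `1` elsewhere.
    have hle : (inner ℂ (ψ z) (φ z)).re ≤ ‖ψ z‖ * ‖φ z‖ :=
      (Complex.re_le_norm _).trans (norm_inner_le_norm _ _)
    refine hle.trans ?_
    have a1 := sq_nonneg (3 * ‖ψ z‖ - 4 * ‖φ z‖)
    have a2 := sq_nonneg (4 * ‖ψ z‖ - 3 * ‖φ z‖)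
    have a3 := sq_nonneg (‖ψ z‖ - ‖φ z‖)
    have a4 := sq_nonneg (‖φ z‖)
    have a5 := sq_nonneg (‖ψ z‖)
    by_cases hP : P z
    · have hQ := hPQ z hP
      simp only [hP, hQ, if_true, if_false]
      nlinarith
    · by_cases hQ : Q z
      · simp only [hP, hQ, if_true, if_false]
        nlinarith
      · simp only [hP, hQ, if_false]
        nlinarith
  refine (Finset.sum_le_sum fun z _ => hz z).trans ?_
  rw [Finset.sum_add_distrib, Finset.sum_sub_distrib, Finset.sum_sub_distrib, ← Finset.mul_sum,
    ← Finset.mul_sum, ← Finset.mul_sum, ← Finset.mul_sum, n1, n2]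
  linarith

/-! ### Inverting a permutation -/

namespace QueryAlgorithm

theorem norm_stateAfter {ℓ : ℕ} {Out : Type} (A : QueryAlgorithm ℓ Out)
    (f : BitString ℓ → BitString ℓ → Option (BitString ℓ)) (t : ℕ) : ‖A.stateAfter f t‖ = 1 := by
  induction t with
  | zero => exact A.norm_init
  | succ t ih => simp [stateAfter, ih]

section inversion

variable {ℓ : ℕ} {Out ι : Type} [Fintype ι] [DecidableEq ι]

/-- The adversary's progress measure: the sum of the inner products of the states after `t` queries
over all pairs of permutations that differ by exchanging the value `x₀` with another value. -/
noncomputable def overlap (A : QueryAlgorithm ℓ Out)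
    (f : Equiv.Perm ι → BitString ℓ → BitString ℓ → Option (BitString ℓ)) (x₀ : ι) (t : ℕ) : ℝ :=
  ∑ π : Equiv.Perm ι, ∑ y ∈ Finset.univ.erase x₀,
    (inner ℂ (A.stateAfter (f π) t) (A.stateAfter (f (Equiv.swap x₀ y * π)) t)).re

theorem overlap_zero (A : QueryAlgorithm ℓ Out)
    (f : Equiv.Perm ι → BitString ℓ → BitString ℓ → Option (BitString ℓ)) (x₀ : ι) :
    A.overlap f x₀ 0 =
      Fintype.card (Equiv.Perm ι) * ((Finset.univ.erase x₀).card : ℝ) := by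
  have : (inner ℂ A.init A.init).re = 1 := by
    rw [inner_self_eq_norm_sq_to_K, A.norm_init]; norm_num
  simp only [overlap, stateAfter, this, Finset.sum_const, nsmul_eq_mul, mul_one,
    Finset.card_univ]

theorem sum_perm_swap_mul (x y : ι) (F : Equiv.Perm ι → ℝ) :
    ∑ π, F (Equiv.swap x y * π) = ∑ π, F π :=
  Fintype.sum_equiv (Equiv.mulLeft (Equiv.swap x y)) _ _ fun _ => rfl

theorem overlap_sub_overlap_succ_le (A : QueryAlgorithm ℓ Out)
    (key : BitString ℓ → BitString ℓ → Option ι)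
    (f : Equiv.Perm ι → BitString ℓ → BitString ℓ → Option (BitString ℓ))
    (hf : ∀ π σ u v, (∀ q, key u v = some q → π q = σ q) → f π u v = f σ u v)
    (x₀ : ι) (t : ℕ) {ε : ℝ} (hε : 0 < ε) :
    A.overlap f x₀ t - A.overlap f x₀ (t + 1) ≤
      Fintype.card (Equiv.Perm ι) *
        (2 * (ε * ((Finset.univ.erase x₀).card : ℝ) + ε⁻¹)) := by
  set w : Equiv.Perm ι → ι → ℝ := fun π q => queryWeight key (A.stateAfter (f π) t) q with hw
  have hone : ∀ π q, w π q ≤ 1 := fun π q => by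
    simpa [norm_stateAfter] using queryWeight_le key (A.stateAfter (f π) t) q
  have hsum : ∀ π, ∑ y ∈ Finset.univ.erase x₀, w π (π⁻¹ y) ≤ 1 := fun π => by
    have := sum_queryWeight_le key (A.stateAfter (f π) t)
      ((Finset.univ.erase x₀).map (π⁻¹ : Equiv.Perm ι).toEmbedding)
    rw [Finset.sum_map, norm_stateAfter, one_pow] at this
    exact this
  have hstep : ∀ π : Equiv.Perm ι, ∀ y ∈ Finset.univ.erase x₀,
      (inner ℂ (A.stateAfter (f π) t) (A.stateAfter (f (Equiv.swap x₀ y * π)) t)).re -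
        (inner ℂ (A.stateAfter (f π) (t + 1))
          (A.stateAfter (f (Equiv.swap x₀ y * π)) (t + 1))).re ≤
      (ε * w π (π⁻¹ x₀) + ε⁻¹ * w π (π⁻¹ y)) +
        (ε * w (Equiv.swap x₀ y * π) ((Equiv.swap x₀ y * π)⁻¹ x₀) +
          ε⁻¹ * w (Equiv.swap x₀ y * π) ((Equiv.swap x₀ y * π)⁻¹ y)) := fun π y _ => by
    have hloc : ∀ u v, key u v ≠ some (π⁻¹ x₀) → key u v ≠ some (π⁻¹ y) →
        f π u v = f (Equiv.swap x₀ y * π) u v := fun u v h1 h2 => by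
      refine hf _ _ _ _ fun q hq => ?_
      rw [Equiv.Perm.mul_apply, Equiv.swap_apply_of_ne_of_ne]
      · rintro rfl; exact h1 (by simpa using hq)
      · rintro rfl; exact h2 (by simpa using hq)
    have := re_inner_sub_re_inner_queryUnitary_le key hloc (A.stateAfter (f π) t)
      (A.stateAfter (f (Equiv.swap x₀ y * π)) t) hε
    simp only [stateAfter, LinearIsometryEquiv.inner_map_map, mul_inv_rev, Equiv.swap_inv,
      Equiv.Perm.mul_apply, Equiv.swap_apply_left, Equiv.swap_apply_right, hw]
    linarith
  have hdiff : A.overlap f x₀ t - A.overlap f x₀ (t + 1) ≤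
      ∑ π : Equiv.Perm ι, ∑ y ∈ Finset.univ.erase x₀,
        ((ε * w π (π⁻¹ x₀) + ε⁻¹ * w π (π⁻¹ y)) +
        (ε * w (Equiv.swap x₀ y * π) ((Equiv.swap x₀ y * π)⁻¹ x₀) +
          ε⁻¹ * w (Equiv.swap x₀ y * π) ((Equiv.swap x₀ y * π)⁻¹ y))) := by
    unfold overlap
    rw [← Finset.sum_sub_distrib]
    refine Finset.sum_le_sum fun π _ => ?_
    rw [← Finset.sum_sub_distrib]
    exact Finset.sum_le_sum (hstep π)
  -- The second half of the summand is the first half at the partner permutation.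
  have hswap : ∑ π : Equiv.Perm ι, ∑ y ∈ Finset.univ.erase x₀,
        (ε * w (Equiv.swap x₀ y * π) ((Equiv.swap x₀ y * π)⁻¹ x₀) +
          ε⁻¹ * w (Equiv.swap x₀ y * π) ((Equiv.swap x₀ y * π)⁻¹ y)) =
      ∑ π : Equiv.Perm ι, ∑ y ∈ Finset.univ.erase x₀,
        (ε * w π (π⁻¹ x₀) + ε⁻¹ * w π (π⁻¹ y)) := by
    rw [Finset.sum_comm, Finset.sum_comm (s := Finset.univ (α := Equiv.Perm ι))]
    refine Finset.sum_congr rfl fun y _ => ?_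
    exact sum_perm_swap_mul x₀ y fun π => ε * w π (π⁻¹ x₀) + ε⁻¹ * w π (π⁻¹ y)
  have hbound : ∑ π : Equiv.Perm ι, ∑ y ∈ Finset.univ.erase x₀,
        (ε * w π (π⁻¹ x₀) + ε⁻¹ * w π (π⁻¹ y)) ≤
      Fintype.card (Equiv.Perm ι) * (ε * ((Finset.univ.erase x₀).card : ℝ) + ε⁻¹) := by
    rw [← nsmul_eq_mul, ← Finset.card_univ (α := Equiv.Perm ι)]
    refine Finset.sum_le_card_nsmul _ _ _ fun π _ => ?_
    rw [Finset.sum_add_distrib, Finset.sum_const, ← Finset.mul_sum, nsmul_eq_mul]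
    have e1 : ((Finset.univ.erase x₀).card : ℝ) * (ε * w π (π⁻¹ x₀)) ≤
        ((Finset.univ.erase x₀).card : ℝ) * (ε * 1) := by
      gcongr
      exact hone _ _
    have e2 : ε⁻¹ * ∑ y ∈ Finset.univ.erase x₀, w π (π⁻¹ y) ≤ ε⁻¹ * 1 :=
      mul_le_mul_of_nonneg_left (hsum π) (inv_pos.2 hε).le
    linarith
  simp only [Finset.sum_add_distrib] at hdiff hswap hbound
  linarith

/-- Quantum lower bound for inverting a permutation. The box `f π` reveals at most one value of the
permutation `π` per query, namely the one at the point `key u v`; if from `f π` the algorithm finds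
the preimage of `x₀`, in the sense of an output satisfying a predicate that determines this
preimage, then it makes at least of the order of the square root of the number of points many
queries. -/
theorem sqrt_le_queries_of_inverts (A : QueryAlgorithm ℓ Out)
    (key : BitString ℓ → BitString ℓ → Option ι)
    (f : Equiv.Perm ι → BitString ℓ → BitString ℓ → Option (BitString ℓ))
    (hf : ∀ π σ u v, (∀ q, key u v = some q → π q = σ q) → f π u v = f σ u v)
    (x₀ : ι) (P : ι → Out → Prop) (hP : ∀ i j o, P i o → P j o → i = j)
    (hA : ∀ π : Equiv.Perm ι, 2 / 3 ≤ A.successProb (f π) (P (π⁻¹ x₀))) :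
    √((Fintype.card ι : ℝ) - 1) / 72 ≤ A.queries := by
  classical
  have hcard : ((Finset.univ.erase x₀).card : ℝ) = (Fintype.card ι : ℝ) - 1 := by
    rw [Finset.card_erase_of_mem (Finset.mem_univ _), Finset.card_univ,
      Nat.cast_sub (Fintype.card_pos_iff.2 ⟨x₀⟩), Nat.cast_one]
  rw [← hcard]
  set n : ℝ := ((Finset.univ.erase x₀).card : ℝ) with hn
  rcases (Nat.cast_nonneg (Finset.univ.erase x₀).card : (0 : ℝ) ≤ _).eq_or_lt with h0 | hpos
  · rw [hn, ← h0]; simp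
  set r := √n with hr
  have hrpos : 0 < r := Real.sqrt_pos.2 hpos
  have hrr : r * r = n := Real.mul_self_sqrt hpos.le
  set G : ℝ := ((Fintype.card (Equiv.Perm ι) : ℕ) : ℝ) with hG
  have hGpos : 0 < G := by
    rw [hG]; exact_mod_cast Fintype.card_pos
  have hstep : ∀ t : ℕ, G * n - t * (G * (4 * r)) ≤ A.overlap f x₀ t := fun t => by
    induction t with
    | zero => rw [overlap_zero]; simp [hG, hn]
    | succ t ih =>
      -- The choice `ε = 1 / √n` balances the two contributions.
      have := A.overlap_sub_overlap_succ_le key f hf x₀ t (inv_pos.2 hrpos)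
      have e : r⁻¹ * n + r⁻¹⁻¹ = 2 * r := by
        rw [← hrr, inv_inv]; field_simp; ring
      rw [← hn, e, ← hG] at this
      push_cast
      linarith
  have hfin : A.overlap f x₀ A.queries ≤ G * (n * (17 / 18)) := by
    unfold overlap
    rw [hG, ← nsmul_eq_mul, ← Finset.card_univ (α := Equiv.Perm ι)]
    refine Finset.sum_le_card_nsmul _ _ _ fun π _ => ?_
    rw [hn, ← nsmul_eq_mul]
    refine Finset.sum_le_card_nsmul _ _ _ fun y hy => ?_
    refine re_inner_le_of_separated (A.norm_stateAfter _ _) (A.norm_stateAfter _ _)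
      (fun z => P (π⁻¹ x₀) (A.out z)) (fun z => P ((Equiv.swap x₀ y * π)⁻¹ x₀) (A.out z)) ?_ ?_ ?_
    · intro z h1 h2
      have := hP _ _ _ h1 h2
      simp only [mul_inv_rev, Equiv.swap_inv, Equiv.Perm.mul_apply, Equiv.swap_apply_left,
        EmbeddingLike.apply_eq_iff_eq] at this
      exact (Finset.ne_of_mem_erase hy) this.symm
    · convert hA π using 1
      unfold successProb
      exact Finset.sum_congr rfl fun z _ => by congr
    · convert hA (Equiv.swap x₀ y * π) using 1
      unfold successProb
      exact Finset.sum_congr rfl fun z _ => by congr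
  have := (hstep A.queries).trans hfin
  have h2 : G * r * (r / 18) ≤ G * r * (4 * A.queries) := by
    rw [← hrr] at this
    linarith
  have := le_of_mul_le_mul_left h2 (by positivity)
  linarith

end inversion

end QueryAlgorithm

/-! ### Hiding an element among annihilating elements -/

theorem isFactorization_unique {S : Type} [CommSemigroup S] {k : ℕ} {g : Fin k → S} {x y : S}
    {a : Fin k → ℕ} (hx : IsFactorization g x a) (hy : IsFactorization g y a) : x = y :=
  WithOne.coe_injective (hx.2.trans hy.2.symm)

section relabel

variable {S : Type} [CommSemigroup S] {ℓ : ℕ}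

open Classical in
/-- If all products with an element of `top` are equal to a fixed element `z`, then
relabelling `top` by a permutation `π` changes the black box only on pairs whose product is in
`top`, where it reveals the value of `π` at the product. -/
theorem blackBoxReply_relabel_congr (enc : S ↪ BitString ℓ) (top : Set S) {z : S}
    (hann : ∀ s ∈ top, ∀ t, s * t = z) (π σ : Equiv.Perm top) (s t : S)
    (h : ∀ q : top, s * t = q → π q = σ q) :
    blackBoxReply ((Equiv.Perm.ofSubtype π).toEmbedding.trans enc) (enc s) (enc t) =
      blackBoxReply ((Equiv.Perm.ofSubtype σ).toEmbedding.trans enc) (enc s) (enc t) := by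
  -- Factors in `top` may be replaced by their images under a relabelling: all products are `z`.
  have key : ∀ τ : Equiv.Perm top,
      blackBoxReply ((Equiv.Perm.ofSubtype τ).toEmbedding.trans enc) (enc s) (enc t) =
        some (enc (Equiv.Perm.ofSubtype τ (s * t))) := fun τ => by
    have hinv : ∀ r : S, r ∉ top → (Equiv.Perm.ofSubtype τ)⁻¹ r = r := fun r hr => by
      rw [← map_inv]; exact Equiv.Perm.ofSubtype_apply_of_not_mem _ hr
    have hmem : ∀ r : S, r ∈ top → (Equiv.Perm.ofSubtype τ)⁻¹ r ∈ top := fun r hr => by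
      rw [← map_inv, Equiv.Perm.ofSubtype_apply_of_mem _ hr]; exact Subtype.coe_prop _
    have hprod : (Equiv.Perm.ofSubtype τ)⁻¹ s * (Equiv.Perm.ofSubtype τ)⁻¹ t = s * t := by
      by_cases hs : s ∈ top
      · rw [hann _ hs, hann _ (hmem s hs)]
      by_cases ht : t ∈ top
      · rw [mul_comm, mul_comm s, hann _ ht, hann _ (hmem t ht)]
      rw [hinv s hs, hinv t ht]
    have := blackBoxReply_enc ((Equiv.Perm.ofSubtype τ).toEmbedding.trans enc)
      ((Equiv.Perm.ofSubtype τ)⁻¹ s) ((Equiv.Perm.ofSubtype τ)⁻¹ t)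
    rw [hprod] at this
    simpa using this
  rw [key, key]
  by_cases hst : s * t ∈ top
  · rw [Equiv.Perm.ofSubtype_apply_of_mem _ hst, Equiv.Perm.ofSubtype_apply_of_mem _ hst,
      h ⟨_, hst⟩ rfl]
  · rw [Equiv.Perm.ofSubtype_apply_of_not_mem _ hst, Equiv.Perm.ofSubtype_apply_of_not_mem _ hst]

/-- A semigroup of order `N` with `k` generators in which many non-generators `s` satisfy
`s * t = z` for all `t` makes constructive membership hard: the label of the target may sit at any
of these elements, and finding where amounts to inverting a permutation. -/
theorem sqrt_ncard_le_of_solves [Finite S] {k N T : ℕ} (hcard : Nat.card S = N) (hℓ : N ≤ 2 ^ ℓ)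
    (g : Fin k → S) (hg : Subsemigroup.closure (Set.range g) = ⊤)
    (top : Set S) {z : S} (hgtop : ∀ i, g i ∉ top)
    (hann : ∀ s ∈ top, ∀ t, s * t = z)
    (A : (Fin k → BitString ℓ) → BitString ℓ → QueryAlgorithm ℓ (Fin k → ℕ))
    (hA : SolvesConstructiveMembership k N ℓ T A) :
    √((top.ncard : ℝ) - 1) / 72 ≤ T := by
  classical
  rcases top.eq_empty_or_nonempty with rfl | ⟨x, hx⟩
  · rw [Set.ncard_empty, Real.sqrt_eq_zero_of_nonpos (by norm_num), zero_div]
    exact Nat.cast_nonneg T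
  have := Fintype.ofFinite S
  obtain ⟨enc⟩ : Nonempty (S ↪ BitString ℓ) := by
    refine Function.Embedding.nonempty_of_card_le ?_
    rw [← Nat.card_eq_fintype_card, hcard]
    simpa using hℓ
  set e : Equiv.Perm top → (S ↪ BitString ℓ) :=
    fun π => (Equiv.Perm.ofSubtype π).toEmbedding.trans enc with he
  -- All instances of the family present the same labels to the algorithm.
  have hlab : ∀ π : Equiv.Perm top, (fun i => e π (g i)) = fun i => enc (g i) := fun π => by
    funext i
    simp [he, Equiv.Perm.ofSubtype_apply_of_not_mem _ (hgtop i)]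
  have hx' : ∀ π : Equiv.Perm top, e π (π⁻¹ ⟨x, hx⟩ : top) = enc x := fun π => by
    simp [he]
  set key : BitString ℓ → BitString ℓ → Option top := fun u v =>
    (Function.partialInv enc u).bind fun s => (Function.partialInv enc v).bind fun t =>
      if h : s * t ∈ top then some ⟨s * t, h⟩ else none with hkey
  have hinst := fun π : Equiv.Perm top => hA S (e π) g (π⁻¹ ⟨x, hx⟩ : top) hcard hg
  simp only [hlab, hx'] at hinst
  have hmain := (A (fun i => enc (g i)) (enc x)).sqrt_le_queries_of_inverts key
    (fun π => blackBoxReply (e π)) ?_ ⟨x, hx⟩ (fun i a => IsFactorization g (i : S) a)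
    (fun i j a hi hj => Subtype.ext (isFactorization_unique hi hj)) fun π => (hinst π).2
  · have hT : ((A (fun i => enc (g i)) (enc x)).queries : ℝ) ≤ T := by
      exact_mod_cast (hinst 1).1
    rw [← Nat.card_coe_set_eq, Nat.card_eq_fintype_card]
    exact hmain.trans hT
  · intro π σ u v h
    have hrange : ∀ τ : Equiv.Perm top, ∀ w, w ∉ Set.range enc → w ∉ Set.range (e τ) := by
      rintro τ w hw ⟨s, rfl⟩
      exact hw ⟨_, rfl⟩
    by_cases hu : u ∈ Set.range enc
    · by_cases hv : v ∈ Set.range enc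
      · obtain ⟨s, rfl⟩ := hu
        obtain ⟨t, rfl⟩ := hv
        refine blackBoxReply_relabel_congr enc top hann π σ s t fun q hq => h q ?_
        simp [hkey, Function.partialInv_left enc.injective, hq]
      · rw [blackBoxReply_eq_none _ (Or.inr (hrange π v hv)),
          blackBoxReply_eq_none _ (Or.inr (hrange σ v hv))]
    · rw [blackBoxReply_eq_none _ (Or.inl (hrange π u hu)),
        blackBoxReply_eq_none _ (Or.inl (hrange σ u hu))]

end relabel

/-! ### Rees quotients of the free commutative semigroup -/

/-- The Rees quotient of the free commutative semigroup on `k` generators by the complement of a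
set `D` of nonzero exponent vectors: its elements are the monomials with exponents in `D`, together
with the zero element `none`. -/
abbrev ReesMonomial {k : ℕ} (D : Finset (Fin k → ℕ)) : Type := Option D

namespace ReesMonomial

variable {k : ℕ} {D : Finset (Fin k → ℕ)}

/-- The class of the monomial with exponent vector `a`, which is zero unless `a ∈ D`. -/
def mk (D : Finset (Fin k → ℕ)) (a : Fin k → ℕ) : ReesMonomial D :=
  if h : a ∈ D then some ⟨a, h⟩ else none

theorem mk_coe (a : D) : mk D a = some a := by simp [mk]

theorem mk_of_mem {a : Fin k → ℕ} (h : a ∈ D) : mk D a = some ⟨a, h⟩ := by simp [mk, h]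

theorem mk_of_notMem {a : Fin k → ℕ} (h : a ∉ D) : mk D a = none := by simp [mk, h]

/-- The product of two elements of the Rees quotient. -/
def mul (s t : ReesMonomial D) : ReesMonomial D :=
  s.bind fun a => t.bind fun b => mk D (a + b)

theorem mul_comm (s t : ReesMonomial D) : mul s t = mul t s := by
  cases s <;> cases t <;> simp [mul, add_comm]

theorem mul_mk_of_lower (hD : ∀ a b : Fin k → ℕ, a ≠ 0 → a + b ∈ D → a ∈ D)
    {a b : Fin k → ℕ} (ha : a ≠ 0) (hb : b ≠ 0) : mul (mk D a) (mk D b) = mk D (a + b) := by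
  by_cases h : a + b ∈ D
  · have h1 := hD a b ha h
    have h2 := hD b a hb (by rwa [add_comm])
    simp [mul, mk, h, h1, h2]
  · rw [mk_of_notMem h]
    by_cases h1 : a ∈ D
    · by_cases h2 : b ∈ D <;> simp [mul, mk, h, h1, h2]
    · simp [mul, mk, h1]

/-- The commutative semigroup structure, for a set `D` that is closed under passing to nonzero
divisors. -/
abbrev commSemigroup (h0 : (0 : Fin k → ℕ) ∉ D)
    (hD : ∀ a b : Fin k → ℕ, a ≠ 0 → a + b ∈ D → a ∈ D) : CommSemigroup (ReesMonomial D) where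
  mul := mul
  mul_comm := mul_comm
  mul_assoc := by
    have hne : ∀ a : D, (a : Fin k → ℕ) ≠ 0 := fun a h => h0 (h ▸ a.2)
    rintro (_ | a) s t
    · rfl
    rcases s with _ | b
    · rfl
    rcases t with _ | c
    · change mul (mul _ _) none = mul _ none
      rw [mul_comm, mul_comm (some a)]; rfl
    · change mul (mul _ _) _ = mul _ (mul _ _)
      have hs : ∀ a b : D, (a + b : Fin k → ℕ) ≠ 0 := fun a b h =>
        hne a (by
          funext i
          have := congrFun h i
          simp only [Pi.add_apply, Pi.zero_apply] at this ⊢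
          omega)
      simp only [← mk_coe]
      rw [mul_mk_of_lower hD (hne a) (hne b), mul_mk_of_lower hD (hne b) (hne c),
        mul_mk_of_lower hD (hs a b) (hne c), mul_mk_of_lower hD (hne a) (hs b c), add_assoc]

theorem closure_range_mk_single (h0 : (0 : Fin k → ℕ) ∉ D)
    (hD : ∀ a b : Fin k → ℕ, a ≠ 0 → a + b ∈ D → a ∈ D)
    {s t : ReesMonomial D} (hs : s ≠ none) (ht : t ≠ none) (hst : mul s t = none) :
    letI := commSemigroup h0 hD
    Subsemigroup.closure (Set.range fun i : Fin k => mk D (Pi.single i 1)) = ⊤ := by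
  let := commSemigroup h0 hD
  set C := Subsemigroup.closure (Set.range fun i : Fin k => mk D (Pi.single i 1)) with hC
  have hmk : ∀ m : ℕ, ∀ a : Fin k → ℕ, ∑ i, a i = m → a ≠ 0 → mk D a ∈ C := by
    intro m
    induction m with
    | zero =>
      intro a ha hne
      refine absurd (funext fun i => ?_) hne
      simpa using (Finset.sum_eq_zero_iff.1 ha) i (Finset.mem_univ i)
    | succ m ih =>
      intro a ha hne
      obtain ⟨i, hi⟩ := Function.ne_iff.1 hne
      have hdec : (a - Pi.single i 1) + Pi.single i 1 = a := by
        funext j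
        rcases eq_or_ne j i with rfl | hj
        · simp only [Pi.zero_apply] at hi
          simp only [Pi.add_apply, Pi.sub_apply, Pi.single_eq_same]
          omega
        · simp [hj]
      have hgen : mk D (Pi.single i 1) ∈ C := Subsemigroup.subset_closure ⟨i, rfl⟩
      by_cases hz : a - Pi.single i 1 = 0
      · rw [hz, zero_add] at hdec
        rwa [← hdec]
      · have hm : ∑ j, (a - Pi.single i 1 : Fin k → ℕ) j = m := by
          have h1 : ∑ j, ((a - Pi.single i 1) + Pi.single i 1 : Fin k → ℕ) j = m + 1 := by
            rw [hdec, ha]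
          simp only [Pi.add_apply, Finset.sum_add_distrib] at h1
          rw [Finset.sum_pi_single' i 1 Finset.univ] at h1
          simpa using h1
        have h1 : (Pi.single i 1 : Fin k → ℕ) ≠ 0 := by simp
        rw [← hdec, ← mul_mk_of_lower hD hz h1]
        exact C.mul_mem (ih _ hm hz) hgen
  have hsome : ∀ a : D, (some a : ReesMonomial D) ∈ C := fun a => by
    rw [← mk_coe]
    exact hmk _ _ rfl fun h => h0 (h ▸ a.2)
  have hall : ∀ s : ReesMonomial D, s ≠ none → s ∈ C := by
    rintro (_ | a) h
    · exact absurd rfl h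
    · exact hsome a
  refine eq_top_iff.2 fun r _ => ?_
  cases r with
  | none => exact hst ▸ C.mul_mem (hall s hs) (hall t ht)
  | some a => exact hsome a

end ReesMonomial

/-! ### Monomials of bounded degree, padded by powers of one generator -/

/-- The nonzero exponent vectors of total degree at most `d`, and the exponents of the powers
`d + 1, …, d + r` of the generator number `0`. The powers bring the order of the semigroup to a
prescribed value. -/
def paddedSimplex (n d r : ℕ) : Finset (Fin (n + 1) → ℕ) :=
  ((Fintype.piFinset fun _ => Finset.range (d + 1)).filter fun a => a ≠ 0 ∧ ∑ i, a i ≤ d) ∪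
    (Finset.Ioc d (d + r)).image fun j => Pi.single 0 j

theorem mem_paddedSimplex {n d r : ℕ} {a : Fin (n + 1) → ℕ} :
    a ∈ paddedSimplex n d r ↔
      a ≠ 0 ∧ (∑ i, a i ≤ d ∨ (a = Pi.single 0 (a 0) ∧ d < a 0 ∧ a 0 ≤ d + r)) := by
  simp only [paddedSimplex, Finset.mem_union, Finset.mem_filter, Fintype.mem_piFinset,
    Finset.mem_range, Finset.mem_image, Finset.mem_Ioc]
  constructor
  · rintro (⟨-, h1, h2⟩ | ⟨j, ⟨h1, h2⟩, rfl⟩)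
    · exact ⟨h1, Or.inl h2⟩
    · refine ⟨?_, Or.inr ?_⟩
      · simp; omega
      · simp [h1, h2]
  · rintro ⟨h1, h2 | ⟨h2, h3, h4⟩⟩
    · refine Or.inl ⟨fun i => ?_, h1, h2⟩
      exact Nat.lt_succ_of_le ((Finset.single_le_sum (fun _ _ => Nat.zero_le _)
        (Finset.mem_univ i)).trans h2)
    · exact Or.inr ⟨a 0, ⟨h3, h4⟩, h2.symm⟩

theorem card_paddedSimplex (n d r : ℕ) :
    (paddedSimplex n d r).card = (paddedSimplex n d 0).card + r := by
  have h : Disjoint ((Fintype.piFinset fun _ : Fin (n + 1) => Finset.range (d + 1)).filter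
      fun a => a ≠ 0 ∧ ∑ i, a i ≤ d) ((Finset.Ioc d (d + r)).image fun j => Pi.single 0 j) := by
    refine Finset.disjoint_left.2 fun a ha hb => ?_
    obtain ⟨j, hj, rfl⟩ := Finset.mem_image.1 hb
    have h1 := (Finset.mem_filter.1 ha).2.2
    rw [Finset.sum_pi_single' 0 j Finset.univ] at h1
    simp only [Finset.mem_univ, if_true] at h1
    have := (Finset.mem_Ioc.1 hj).1
    omega
  rw [paddedSimplex, Finset.card_union_of_disjoint h,
    Finset.card_image_of_injective _ (Pi.single_injective 0)]
  simp [paddedSimplex]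

theorem card_paddedSimplex_zero_le (n d : ℕ) :
    (paddedSimplex n d 0).card ≤ (d + 1) ^ (n + 1) := by
  have : paddedSimplex n d 0 ⊆ Fintype.piFinset fun _ => Finset.range (d + 1) := by
    simp [paddedSimplex, Finset.filter_subset]
  simpa using Finset.card_le_card this

theorem sum_pos_of_ne_zero {k : ℕ} {b : Fin k → ℕ} (hb : b ≠ 0) : 0 < ∑ i, b i := by
  refine Nat.pos_of_ne_zero fun h => hb (funext fun i => ?_)
  simpa using (Finset.sum_eq_zero_iff.1 h) i (Finset.mem_univ i)

theorem mem_paddedSimplex_of_add {n d r : ℕ} {a b : Fin (n + 1) → ℕ} (ha : a ≠ 0)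
    (h : a + b ∈ paddedSimplex n d r) : a ∈ paddedSimplex n d r := by
  obtain ⟨-, h | ⟨h1, -, h3⟩⟩ := mem_paddedSimplex.1 h
  · refine mem_paddedSimplex.2 ⟨ha, Or.inl ?_⟩
    simp only [Pi.add_apply, Finset.sum_add_distrib] at h
    omega
  · have e : a = Pi.single 0 (a 0) := by
      funext i
      rcases eq_or_ne i 0 with rfl | hi
      · simp
      · have := congrFun h1 i
        simp only [Pi.add_apply, Pi.single_eq_of_ne hi] at this ⊢
        omega
    refine mem_paddedSimplex.2 ⟨ha, ?_⟩
    rcases le_or_gt (a 0) d with hd | hd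
    · left
      rw [e, Finset.sum_pi_single' 0 (a 0) Finset.univ]
      simpa using hd
    · exact Or.inr ⟨e, hd, by simp only [Pi.add_apply] at h3; omega⟩

/-- The exponent vectors of total degree `d` other than that of the `d`-th power of the generator
number `0`. The products of these monomials with any element vanish. -/
def topLayer (n d : ℕ) : Set (Fin (n + 1) → ℕ) := {a | ∑ i, a i = d ∧ a 0 ≠ d}

theorem add_notMem_paddedSimplex {n d r : ℕ} {a b : Fin (n + 1) → ℕ} (ha : a ∈ topLayer n d)
    (hb : b ≠ 0) : a + b ∉ paddedSimplex n d r := by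
  intro h
  obtain ⟨h1, h2⟩ := ha
  have hpos := sum_pos_of_ne_zero hb
  obtain ⟨-, h | ⟨h, -⟩⟩ := mem_paddedSimplex.1 h
  · simp only [Pi.add_apply, Finset.sum_add_distrib] at h
    omega
  · refine h2 ?_
    rw [← h1, Finset.sum_eq_single 0]
    · intro i _ hi
      have := congrFun h i
      simp only [Pi.add_apply, Pi.single_eq_of_ne hi] at this
      omega
    · simp

theorem topLayer_subset_paddedSimplex {n d r : ℕ} (hd : 0 < d) {a : Fin (n + 1) → ℕ}
    (ha : a ∈ topLayer n d) : a ∈ paddedSimplex n d r := by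
  refine mem_paddedSimplex.2 ⟨?_, Or.inl ha.1.le⟩
  rintro rfl
  have := ha.1
  simp at this
  omega

/-- The last `n` exponents of a vector in the top layer may be prescribed arbitrarily in
`{1, …, m}` if the degree is `n * m`. -/
theorem pow_le_ncard_topLayer {n m : ℕ} (hn : 0 < n) (hfin : (topLayer n (n * m)).Finite) :
    m ^ n ≤ (topLayer n (n * m)).ncard := by
  set F : (Fin n → Fin m) → (Fin (n + 1) → ℕ) := fun b =>
    Fin.cons (n * m - ∑ i, ((b i : ℕ) + 1)) fun i => (b i : ℕ) + 1 with hF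
  have hinj : Function.Injective F := fun b b' h => by
    funext i
    have := congrFun h i.succ
    simp only [hF, Fin.cons_succ] at this
    exact Fin.ext (by omega)
  have hmem : ∀ b, F b ∈ topLayer n (n * m) := fun b => by
    have hle : ∑ i, ((b i : ℕ) + 1) ≤ n * m := by
      have := Finset.sum_le_card_nsmul Finset.univ (fun i => (b i : ℕ) + 1) m fun i _ => (b i).2
      simpa using this
    have hpos : 0 < ∑ i, ((b i : ℕ) + 1) :=
      Finset.sum_pos (fun _ _ => Nat.succ_pos _) ⟨⟨0, hn⟩, Finset.mem_univ _⟩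
    constructor
    · rw [Fin.sum_univ_succ]
      simp only [hF, Fin.cons_zero, Fin.cons_succ]
      omega
    · simp only [hF, Fin.cons_zero]
      omega
  calc m ^ n = (Set.range F).ncard := by
        rw [← Nat.card_coe_set_eq, Nat.card_range_of_injective hinj]
        simp
    _ ≤ _ := Set.ncard_le_ncard (Set.range_subset_iff.2 hmem) hfin

/-! ### The lower bound -/

theorem sqrt_pow_le_of_solves {n m N ℓ T : ℕ} (hn : 0 < n) (hm : 2 ≤ m)
    (hN : (n * m + 2) ^ (n + 1) ≤ N) (hℓ : N ≤ 2 ^ ℓ)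
    (A : (Fin (n + 1) → BitString ℓ) → BitString ℓ → QueryAlgorithm ℓ (Fin (n + 1) → ℕ))
    (hA : SolvesConstructiveMembership (n + 1) N ℓ T A) :
    √((m : ℝ) ^ n - 1) / 72 ≤ T := by
  have hd : 2 ≤ n * m := by nlinarith
  set d := n * m with hd'
  have hcard0 : (paddedSimplex n d 0).card + 1 ≤ N := by
    have h1 := card_paddedSimplex_zero_le n d
    have h2 : (d + 1) ^ (n + 1) < (d + 2) ^ (n + 1) :=
      Nat.pow_lt_pow_left (by omega) (by omega)
    omega
  set r := N - ((paddedSimplex n d 0).card + 1) with hr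
  set D := paddedSimplex n d r with hD
  have h0 : (0 : Fin (n + 1) → ℕ) ∉ D := fun h => (mem_paddedSimplex.1 h).1 rfl
  have hlow : ∀ a b : Fin (n + 1) → ℕ, a ≠ 0 → a + b ∈ D → a ∈ D :=
    fun a b ha h => mem_paddedSimplex_of_add ha h
  let := ReesMonomial.commSemigroup h0 hlow
  have hcard : Nat.card (ReesMonomial D) = N := by
    have : D.card = (paddedSimplex n d 0).card + r := card_paddedSimplex n d r
    rw [Nat.card_eq_fintype_card, Fintype.card_option, Fintype.card_coe]
    omega
  have hmemD : ∀ a ∈ topLayer n d, a ∈ D := fun a ha =>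
    topLayer_subset_paddedSimplex (by omega) ha
  have hfin : (topLayer n d).Finite := D.finite_toSet.subset hmemD
  set top : Set (ReesMonomial D) := ReesMonomial.mk D '' topLayer n d with htop
  have hinj : Set.InjOn (ReesMonomial.mk D) (topLayer n d) := by
    intro a ha b hb h
    rw [ReesMonomial.mk_of_mem (hmemD a ha), ReesMonomial.mk_of_mem (hmemD b hb)] at h
    simpa using h
  have hann : ∀ s ∈ top, ∀ t : ReesMonomial D, s * t = none := by
    rintro _ ⟨a, ha, rfl⟩ t
    change ReesMonomial.mul _ _ = _
    rw [ReesMonomial.mk_of_mem (hmemD a ha)]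
    rcases t with _ | b
    · rfl
    · exact ReesMonomial.mk_of_notMem
        (add_notMem_paddedSimplex ha fun h => h0 (h ▸ b.2))
  have hnone : (none : ReesMonomial D) ∉ top := by
    rintro ⟨a, ha, h⟩
    rw [ReesMonomial.mk_of_mem (hmemD a ha)] at h
    simp at h
  have hpow : m ^ n ≤ top.ncard := by
    rw [htop, hinj.ncard_image]
    exact pow_le_ncard_topLayer hn hfin
  obtain ⟨s, hs⟩ : top.Nonempty := by
    refine Set.nonempty_of_ncard_ne_zero ?_
    have : 0 < m ^ n := by positivity
    omega
  have hgen : ∀ i : Fin (n + 1), ReesMonomial.mk D (Pi.single i 1) ∉ top := by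
    rintro i ⟨a, ha, h⟩
    have hdeg : ∑ j, (Pi.single i 1 : Fin (n + 1) → ℕ) j = 1 := by
      rw [Finset.sum_pi_single' i 1 Finset.univ]; simp
    have hi : (Pi.single i 1 : Fin (n + 1) → ℕ) ∈ D :=
      mem_paddedSimplex.2 ⟨by simp, Or.inl (by omega)⟩
    rw [ReesMonomial.mk_of_mem (hmemD a ha), ReesMonomial.mk_of_mem hi] at h
    have h' : a = Pi.single i 1 := by simpa using h
    have := ha.1
    rw [h', hdeg] at this
    omega
  have hsne : s ≠ none := fun h => hnone (h ▸ hs)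
  have hbound := sqrt_ncard_le_of_solves hcard hℓ _
    (ReesMonomial.closure_range_mk_single h0 hlow hsne hsne (hann s hs s)) top hgen hann A hA
  have : (m : ℝ) ^ n ≤ top.ncard := by exact_mod_cast hpow
  refine le_trans ?_ hbound
  gcongr

theorem theorem2 (k : ℕ) (hk : 2 ≤ k) :
    ∃ c : ℝ, 0 < c ∧ ∃ N₀ : ℕ, ∀ N : ℕ, N₀ ≤ N → ∀ ℓ : ℕ, N ≤ 2 ^ ℓ →
      ∀ (T : ℕ) (A : (Fin k → BitString ℓ) → BitString ℓ → QueryAlgorithm ℓ (Fin k → ℕ)),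
        SolvesConstructiveMembership k N ℓ T A →
          c * (N : ℝ) ^ ((1 : ℝ) / 2 - 1 / (2 * (k : ℝ))) ≤ (T : ℝ) := by
  obtain ⟨n, rfl⟩ : ∃ n, k = n + 1 := ⟨k - 1, by omega⟩
  have hn : 0 < n := by omega
  have hn1 : (1 : ℝ) ≤ n := by exact_mod_cast hn
  refine ⟨√((1 / (6 * n)) ^ n / 2) / 72, by positivity, (12 * n) ^ (n + 1), ?_⟩
  intro N hN ℓ hℓ T A hA
  -- With `X` the `k`-th root of `N`, the degree is about `X / 3`.
  set X : ℝ := (N : ℝ) ^ ((1 : ℝ) / ((n + 1 : ℕ) : ℝ)) with hX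
  have hXpow : X ^ (n + 1) = N := by
    rw [hX, one_div]
    exact Real.rpow_inv_natCast_pow (Nat.cast_nonneg N) (by omega)
  have hX0 : 0 ≤ X := by positivity
  have hX12 : 12 * (n : ℝ) ≤ X := by
    refine le_of_pow_le_pow_left₀ (n := n + 1) (by omega) hX0 ?_
    rw [hXpow]
    exact_mod_cast hN
  set m := ⌊X / (3 * n)⌋₊ with hm
  have hm1 : (m : ℝ) ≤ X / (3 * n) := Nat.floor_le (by positivity)
  have hm2 : X / (3 * n) < m + 1 := Nat.lt_floor_add_one _
  have h4 : 4 ≤ X / (3 * n) := by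
    rw [le_div_iff₀ (by positivity)]; linarith
  have hm3 : 2 ≤ m := by
    rw [hm]; exact Nat.le_floor (by norm_num; linarith)
  have hsize : (n * m + 2) ^ (n + 1) ≤ N := by
    have h : (n * m + 2 : ℝ) ≤ X := by
      rw [le_div_iff₀ (by positivity)] at hm1
      nlinarith
    have h2 : (n * m + 2 : ℝ) ^ (n + 1) ≤ N := by
      rw [← hXpow]
      gcongr
    exact_mod_cast h2
  refine le_trans ?_ (sqrt_pow_le_of_solves hn hm3 hsize hℓ A hA)
  have hexp : (N : ℝ) ^ ((1 : ℝ) / 2 - 1 / (2 * ((n + 1 : ℕ) : ℝ))) = √(X ^ n) := by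
    rw [Real.sqrt_eq_rpow, hX, ← Real.rpow_natCast, ← Real.rpow_mul (Nat.cast_nonneg N),
      ← Real.rpow_mul (Nat.cast_nonneg N)]
    congr 1
    push_cast
    field_simp
    ring
  have hfrac : X / (6 * n) ≤ m := by
    have : X / (6 * n) = X / (3 * n) / 2 := by field_simp; ring
    rw [this]; linarith
  have hmn : (1 / (6 * n)) ^ n / 2 * X ^ n ≤ (m : ℝ) ^ n - 1 := by
    have h1 : (1 / (6 * (n : ℝ))) ^ n * X ^ n ≤ (m : ℝ) ^ n := by
      rw [← mul_pow, one_div_mul_eq_div]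
      gcongr
    have h2 : (2 : ℝ) ≤ (m : ℝ) ^ n := by
      have : 2 ^ 1 ≤ m ^ n := (Nat.pow_le_pow_right (by omega) hn).trans (Nat.pow_le_pow_left hm3 n)
      exact_mod_cast this
    linarith
  rw [hexp, div_mul_eq_mul_div, ← Real.sqrt_mul (by positivity)]
  gcongr
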